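/- Let $0<x_0<1$ and $x_n=x_{n-1}(1-x_{n-1})$ for $n\ge 1$. Define the polynomials $$P_1(X)=X,\qquad P_2(X)=X^2+X+\tfrac12,\qquad P_3(X)=X^3+\tfrac52X^2+\tfrac52X+\tfrac56,$$ $$P_4(X)=X^4+\tfrac{13}{3}X^3+\tfrac{15}{2}X^2+\tfrac{35}{6}X+\tfrac{61}{36},$$ $$P_5(X)=X^5+\tfrac{77}{12}X^4+\tfrac{101}{6}X^3+\tfrac{265}{12}X^2+\tfrac{515}{36}X+\tfrac{2609}{720},$$ $$P_6(X)=X^6+\tfrac{87}{10}X^5+\tfrac{95}{3}X^4+61X^3+65X^2+\tfrac{12977}{360}X+\tfrac{29069}{3600}.$$ There is a constant $C=C(x_0)$, depending only on $x_0$, such that, as $n\to\infty$, $$x_n\sim\frac1n\Bigl\{1+\sum_{m=1}^{6}P_m\bigl(-[\ln n+C]\bigr)\frac1{n^m}\Bigr\}\qquad\text{(A)}$$ in the sense of asymptotic expansions, that is, for every $0\le M\le 6$, $$x_n=\frac1n\Bigl\{1+\sum_{m=1}^{M}P_m\bigl(-[\ln n+C]\bigr)\frac1{n^m}\Bigr\}+O\!\left(\frac{(\ln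 n)^{M+1}}{n^{M+2}}\right).$$ In particular, with the same $C$ and with $L=\ln n$, the expansion in the terms $(\ln n)^k/n^m$, $m\le 6$, is $$\begin{aligned} x_n={}&\frac1n-\frac{L+C}{n^2}+\frac{1}{n^3}\Bigl[L^2+(2C-1)L+\bigl(C^2-C+\tfrac12\bigr)\Bigr]\\ &-\frac1{n^4}\Bigl[L^3+\bigl(3C-\tfrac52\bigr)L^2+\bigl(3C^2-5C+\tfrac52\bigr)L+\bigl(C^3-\tfrac52C^2+\tfrac52C-\tfrac56\bigr)\Bigr]\\ &+\frac1{n^5}\Bigl[L^4+\bigl(4C-\tfrac{13}3\bigr)L^3+\bigl(6C^2-13C+\tfrac{15}2\bigr)L^2+\bigl(4C^3-13C^2+15C-\tfrac{35}6\bigr)L\\ &\qquad+\bigl(C^4-\tfrac{13}3C^3+\tfrac{15}2C^2-\tfrac{35}6C+\tfrac{61}{36}\bigr)\Bigr]\\ &-\frac1{n^6}\Bigl[L^5+\bigl(5C-\tfrac{77}{12}\bigr)L^4+\bigl(10C^2-\tfrac{77}3C+\tfrac{101}6\bigr)L^3+\bigl(10C^3-\tfrac{77}2C^2+\tfrac{101}2C-\tfrac{265}{12}\bigr)L^2\\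 &\qquad+\bigl(5C^4-\tfrac{77}3C^3+\tfrac{101}2C^2-\tfrac{265}6C+\tfrac{515}{36}\bigr)L\\ &\qquad+\bigl(C^5-\tfrac{77}{12}C^4+\tfrac{101}6C^3-\tfrac{265}{12}C^2+\tfrac{515}{36}C-\tfrac{2609}{720}\bigr)\Bigr]+O\!\left(\frac{L^6}{n^7}\right). \end{aligned}$$ -/

import Mathlib

open Filter Asymptotics

/-- The explicit polynomials `P₀, …, P₆` attached to the logistic map `x ↦ x (1 - x)`, as
polynomial functions of a real variable `X`. Only the indices `0, …, 6` are meaningful. -/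
noncomputable def logisticP (m : ℕ) (X : ℝ) : ℝ :=
  match m with
  | 0 => 1
  | 1 => X
  | 2 => X ^ 2 + X + 1 / 2
  | 3 => X ^ 3 + 5 / 2 * X ^ 2 + 5 / 2 * X + 5 / 6
  | 4 => X ^ 4 + 13 / 3 * X ^ 3 + 15 / 2 * X ^ 2 + 35 / 6 * X + 61 / 36
  | 5 => X ^ 5 + 77 / 12 * X ^ 4 + 101 / 6 * X ^ 3 + 265 / 12 * X ^ 2 + 515 / 36 * X
          + 2609 / 720
  | 6 => X ^ 6 + 87 / 10 * X ^ 5 + 95 / 3 * X ^ 4 + 61 * X ^ 3 + 65 * X ^ 2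
          + 12977 / 360 * X + 29069 / 3600
  | _ => 0

/-- The partial sum of order `M` of formula (A) for the logistic map, with constant `C`:
`(1 / n) * {1 + ∑_{m=1}^{M} P_m (-(ln n + C)) / n ^ m}`. -/
noncomputable def logisticPartialSum (C : ℝ) (M n : ℕ) : ℝ :=
  1 / (n : ℝ) *
    (1 + ∑ m ∈ Finset.Icc 1 M, logisticP m (-(Real.log n + C)) * (1 / (n : ℝ) ^ m))

/-- The expansion in the scale `ln (n) ^ k / n ^ m`, `m ≤ 6`, written out, where `L` stands for
`ln n` and `N` for `n`. -/
noncomputable def logisticExpanded (C L N : ℝ) : ℝ :=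
  1 / N
    - L / N ^ 2 - C / N ^ 2
    + L ^ 2 / N ^ 3 + (2 * C - 1) * (L / N ^ 3) + (C ^ 2 - C + 1 / 2) * (1 / N ^ 3)
    - L ^ 3 / N ^ 4 - (3 * C - 5 / 2) * (L ^ 2 / N ^ 4)
    - (3 * C ^ 2 - 5 * C + 5 / 2) * (L / N ^ 4)
    - (C ^ 3 - 5 / 2 * C ^ 2 + 5 / 2 * C - 5 / 6) * (1 / N ^ 4)
    + L ^ 4 / N ^ 5 + (4 * C - 13 / 3) * (L ^ 3 / N ^ 5)
    + (6 * C ^ 2 - 13 * C + 15 / 2) * (L ^ 2 / N ^ 5)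
    + (4 * C ^ 3 - 13 * C ^ 2 + 15 * C - 35 / 6) * (L / N ^ 5)
    + (C ^ 4 - 13 / 3 * C ^ 3 + 15 / 2 * C ^ 2 - 35 / 6 * C + 61 / 36) * (1 / N ^ 5)
    - L ^ 5 / N ^ 6 - (5 * C - 77 / 12) * (L ^ 4 / N ^ 6)
    - (10 * C ^ 2 - 77 / 3 * C + 101 / 6) * (L ^ 3 / N ^ 6)
    - (10 * C ^ 3 - 77 / 2 * C ^ 2 + 101 / 2 * C - 265 / 12) * (L ^ 2 / N ^ 6)
    - (5 * C ^ 4 - 77 / 3 * C ^ 3 + 101 / 2 * C ^ 2 - 265 / 6 * C + 515 / 36) * (L / N ^ 6)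
    - (C ^ 5 - 77 / 12 * C ^ 4 + 101 / 6 * C ^ 3 - 265 / 12 * C ^ 2 + 515 / 36 * C
        - 2609 / 720) * (1 / N ^ 6)

/-! Write Φ for `logisticAbel` and e = 1/n. The coefficients of Φ make Φ(x(1 - x)) = Φ(x) + 1 +
O(x^7). Since x_n ≤ 1/n, the increments of Φ(x_n) - n are O(n^(-7)), so this sequence converges to
some C and Φ(x_n) = n + C + O(n^(-6)). It remains to invert Φ asymptotically.

The partial sum z_n of order 6 is an approximate inverse: put z_n = e(1 + w) and X = -(log n + C),
and expand e(Φ(z_n) - n - C) in powers of e with coefficients polynomial in X. The P_m are exactly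
what makes all terms of degree below 7 vanish (`coeff_abelJet_eq_zero`). `HasJet` turns this formal
cancellation into the bound O((log n / n)^7).

Near 0 the term 1/x dominates Φ, so |1/x - 1/z| ≤ 2|Φ(x) - Φ(z)| (`abs_inv_sub_inv_le`). Multiplying
by x_n z_n = O(n^(-2)) gives x_n - z_n = O((log n)^7 / n^8); smaller M follow by truncation. -/

/-- The polynomial part of an approximate Abel function of `x ↦ x (1 - x)` at `0`. -/
noncomputable def abelPoly (x : ℝ) : ℝ :=
  1 / 2 * x + 1 / 3 * x ^ 2 + 13 / 36 * x ^ 3 + 113 / 240 * x ^ 4 + 1187 / 1800 * x ^ 5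

/-- An approximate Abel function of `x ↦ x (1 - x)`: it increases by `1 + O(x ^ 7)` along the
map. -/
noncomputable def logisticAbel (x : ℝ) : ℝ :=
  x⁻¹ + Real.log x + abelPoly x

/-! ### Stability: controlling `x⁻¹` by the approximate Abel function. -/

lemma abs_abelPoly_sub_le {x z : ℝ} (hx : 0 < x) (hz : 0 < z) (hx' : x ≤ 1 / 8)
    (hz' : z ≤ 1 / 8) : |abelPoly x - abelPoly z| ≤ |x - z| := by
  have key (k : ℕ) : |x ^ k - z ^ k| ≤ |x - z| * (k * (1 / 8) ^ (k - 1)) := by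
    refine (abs_pow_sub_pow_le x z k).trans ?_
    rw [mul_assoc]
    have : max |x| |z| ≤ 1 / 8 := by
      rw [abs_of_pos hx, abs_of_pos hz]; exact max_le hx' hz'
    gcongr
  have h2 := key 2
  have h3 := key 3
  have h4 := key 4
  have h5 := key 5
  norm_num at h2 h3 h4 h5
  have hd : abelPoly x - abelPoly z = 1 / 2 * (x - z) + 1 / 3 * (x ^ 2 - z ^ 2)
      + 13 / 36 * (x ^ 3 - z ^ 3) + 113 / 240 * (x ^ 4 - z ^ 4)
      + 1187 / 1800 * (x ^ 5 - z ^ 5) := by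
    unfold abelPoly; ring
  have h1 := le_abs_self (x - z)
  have h1' := neg_abs_le (x - z)
  rw [abs_le] at h2 h3 h4 h5
  rw [hd, abs_le]
  constructor <;> linarith [abs_nonneg (x - z)]

lemma log_sub_log_le {x z : ℝ} (hx : 0 < x) (hz : 0 < z) (hx' : x ≤ 1 / 8) :
    Real.log x - Real.log z ≤ 1 / 8 * |x⁻¹ - z⁻¹| := by
  rw [← Real.log_div hx.ne' hz.ne']
  have h := Real.log_le_sub_one_of_pos (div_pos hx hz)
  have e : x / z - 1 = x * (z⁻¹ - x⁻¹) := by field_simp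
  rw [e] at h
  rw [abs_sub_comm]
  calc _ ≤ _ := h
    _ ≤ x * |z⁻¹ - x⁻¹| := by gcongr; exact le_abs_self _
    _ ≤ _ := by gcongr

/-- In the coordinate 1/x the function is the identity plus a perturbation of Lipschitz constant at
most 1/8 (logarithm) + 1/64 (polynomial part) < 1/2, which is absorbed on the left. -/
lemma abs_inv_sub_inv_le {x z : ℝ} (hx : 0 < x) (hz : 0 < z) (hx' : x ≤ 1 / 8)
    (hz' : z ≤ 1 / 8) : |x⁻¹ - z⁻¹| ≤ 2 * |logisticAbel x - logisticAbel z| := by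
  have hp := abs_abelPoly_sub_le hx hz hx' hz'
  have e : x - z = (x * z) * (z⁻¹ - x⁻¹) := by field_simp
  have hxz : |x - z| ≤ 1 / 64 * |x⁻¹ - z⁻¹| := by
    rw [e, abs_mul, abs_of_pos (mul_pos hx hz), abs_sub_comm x⁻¹]
    have : x * z ≤ 1 / 8 * (1 / 8) := by gcongr
    gcongr
    linarith
  have hl1 := log_sub_log_le hx hz hx'
  have hl2 := log_sub_log_le hz hx hz'
  rw [abs_sub_comm z⁻¹] at hl2
  have hd : x⁻¹ - z⁻¹ = (logisticAbel x - logisticAbel z) - (Real.log x - Real.log z)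
      - (abelPoly x - abelPoly z) := by unfold logisticAbel; ring
  have h3 := abs_le.1 (hp.trans hxz)
  have h4 := le_abs_self (logisticAbel x - logisticAbel z)
  have h5 := neg_abs_le (logisticAbel x - logisticAbel z)
  have h6 : |x⁻¹ - z⁻¹| ≤ |logisticAbel x - logisticAbel z| + 1 / 2 * |x⁻¹ - z⁻¹| := by
    have h0 := abs_nonneg (x⁻¹ - z⁻¹)
    conv_lhs => rw [hd]
    rw [abs_le]
    constructor <;> linarith
  linarith

/-! ### Taylor remainders and the Abel equation up to `O(x ^ 7)`. -/

/-- Taylor expansion of `log (1 + w)` at `0`. -/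
lemma log_one_add_isBigO (N : ℕ) :
    (fun w : ℝ => Real.log (1 + w) + ∑ i ∈ Finset.range N, (-w) ^ (i + 1) / (i + 1))
      =O[nhds 0] fun w => w ^ (N + 1) := by
  refine IsBigO.of_bound 2 ?_
  have : ∀ᶠ w : ℝ in nhds 0, |w| < 1 / 2 :=
    (continuous_abs.tendsto' 0 0 (by simp)).eventually_lt_const (by norm_num)
  filter_upwards [this] with w hw
  have h := Real.abs_log_sub_add_sum_range_le (x := -w) (by rw [abs_neg]; linarith) N
  rw [sub_neg_eq_add, abs_neg, add_comm] at h
  rw [Real.norm_eq_abs, norm_pow, Real.norm_eq_abs]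
  refine h.trans ?_
  rw [div_le_iff₀ (by linarith)]
  nlinarith [pow_nonneg (abs_nonneg w) (N + 1)]

/-- Taylor expansion of `(1 + w)⁻¹` at `0`. -/
lemma inv_one_add_isBigO (N : ℕ) :
    (fun w : ℝ => (1 + w)⁻¹ - ∑ i ∈ Finset.range N, (-w) ^ i) =O[nhds 0] fun w => w ^ N := by
  have h1 : (fun w : ℝ => (1 + w)⁻¹) =O[nhds 0] (fun _ => (1 : ℝ)) := by
    have h : ContinuousAt (fun w : ℝ => (1 + w)⁻¹) 0 :=
      (continuousAt_const.add continuousAt_id).inv₀ (by norm_num)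
    exact h.tendsto.isBigO_one ℝ
  have h2 : (fun w : ℝ => (-w) ^ N) =O[nhds 0] fun w => w ^ N :=
    ((isBigO_refl (fun w : ℝ => w) _).neg_left).pow N
  refine ((h2.mul h1).congr' ?_ (by simp))
  have : ∀ᶠ w : ℝ in nhds 0, w ≠ -1 := isOpen_ne.mem_nhds (by norm_num)
  filter_upwards [this] with w hw
  have hw' : 1 + w ≠ 0 := fun h => hw (by linarith)
  have := geom_sum_mul (-w) N
  field_simp
  linarith

/-- This is Φ(x(1 - x)) - Φ(x) - 1 with the singular terms 1/x and log x already cancelled. The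
logarithm removes the term in x, and the five coefficients of `abelPoly` remove x^2, …, x^6. -/
lemma logisticAbel_step_isBigO :
    (fun x : ℝ => (1 + -x)⁻¹ + Real.log (1 + -x) + (abelPoly (x * (1 - x)) - abelPoly x) - 1)
      =O[nhds 0] fun x => x ^ 7 := by
  have ht : Tendsto (fun x : ℝ => -x) (nhds 0) (nhds 0) := continuous_neg.tendsto' 0 0 (by simp)
  have hneg : (fun x : ℝ => (-x) ^ 7) =O[nhds 0] fun x => x ^ 7 :=
    ((isBigO_refl (fun w : ℝ => w) _).neg_left).pow 7
  have h1 := ((inv_one_add_isBigO 7).comp_tendsto ht).trans hneg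
  have h2 := ((log_one_add_isBigO 6).comp_tendsto ht).trans hneg
  have hq : ∃ q : ℝ → ℝ, Continuous q ∧ ∀ x, abelPoly (x * (1 - x)) - abelPoly x
      + (∑ i ∈ Finset.range 7, (- -x) ^ i) - 1
      - (∑ i ∈ Finset.range 6, (- -x) ^ (i + 1) / ((i : ℝ) + 1)) = x ^ 7 * q x := by
    -- The Taylor polynomials combine to a polynomial of degree 10 divisible by x^7; this cubic is
    -- the quotient.
    refine ⟨fun x => (212/45) + (-4409/720) * x + (1187/360) * x ^ 2 + (-1187/1800) * x ^ 3, by fun_prop, fun x => ?_⟩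
    unfold abelPoly
    simp only [Finset.sum_range_succ, Finset.sum_range_zero]
    push_cast
    ring
  obtain ⟨q, hqc, hq⟩ := hq
  have h3 : (fun x : ℝ => x ^ 7 * q x) =O[nhds 0] fun x => x ^ 7 := by
    simpa using (isBigO_refl (fun x : ℝ => x ^ 7) (nhds 0)).mul ((hqc.tendsto 0).isBigO_one ℝ)
  refine ((h1.add h2).add h3).congr_left fun x => ?_
  rw [← hq]
  simp only [Function.comp]
  ring

/-! ### Convergence along orbits. -/

/-- A real sequence with increments `O(n ^ (-(k + 2)))` converges, with error
`O(n ^ (-(k + 1)))`. -/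
lemma exists_lim_of_increment_isBigO {d : ℕ → ℝ} {k : ℕ}
    (h : (fun n => d (n + 1) - d n) =O[atTop] fun n : ℕ => 1 / (n : ℝ) ^ (k + 2)) :
    ∃ C, (fun n => d n - C) =O[atTop] fun n : ℕ => 1 / (n : ℝ) ^ (k + 1) := by
  obtain ⟨K, hK, h⟩ := h.exists_pos
  rw [IsBigOWith, eventually_atTop] at h
  obtain ⟨N, hN⟩ := h
  set N' := max N 1
  -- A telescoping majorant: K / n^(k+2) ≤ b n - b (n+1), because 1/n ≤ 2/(n+1) for n ≥ 1.
  set b : ℕ → ℝ := fun n => 2 * K * (1 / (n : ℝ) ^ (k + 1)) with hb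
  have hb0 (n) : 0 ≤ b n := by positivity
  have step (n) (hn : N' ≤ n) : |d (n + 1) - d n| ≤ b n - b (n + 1) := by
    have hn1 : (1 : ℝ) ≤ n := by exact_mod_cast (le_max_right N 1).trans hn
    have h1 := hN n ((le_max_left N 1).trans hn)
    rw [Real.norm_eq_abs, Real.norm_of_nonneg (by positivity)] at h1
    refine h1.trans ?_
    have h2 : 1 / ((n : ℝ) + 1) ^ (k + 1) ≤ 1 / (n : ℝ) ^ k * (1 / (n + 1)) := by
      rw [pow_succ, one_div_mul_one_div]
      gcongr
      linarith
    have h3 : 1 / (n : ℝ) ^ (k + 1) - 1 / (n : ℝ) ^ k * (1 / (n + 1))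
        = 1 / (n : ℝ) ^ (k + 1) * (1 / (n + 1)) := by
      field_simp
      ring
    have h4 : 1 / (n : ℝ) ^ (k + 2) ≤ 1 / (n : ℝ) ^ (k + 1) * (2 * (1 / (n + 1))) := by
      have : 1 / (n : ℝ) ≤ 2 * (1 / (n + 1)) := by
        rw [mul_one_div, div_le_div_iff₀] <;> linarith
      calc 1 / (n : ℝ) ^ (k + 2) = 1 / (n : ℝ) ^ (k + 1) * (1 / n) := by rw [one_div_mul_one_div, pow_succ]
        _ ≤ _ := by gcongr
    simp only [hb]
    push_cast
    nlinarith
  have tail (n) (hn : N' ≤ n) (j : ℕ) : |d (n + j) - d n| ≤ b n - b (n + j) := by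
    induction j with
    | zero => simp
    | succ j ih =>
      have := step (n + j) (by omega)
      have e : d (n + (j + 1)) - d n = (d (n + j + 1) - d (n + j)) + (d (n + j) - d n) := by
        rw [← add_assoc]; ring
      rw [e, ← add_assoc]
      refine (abs_add_le _ _).trans ?_
      linarith
  have hbt : Tendsto b atTop (nhds 0) := by
    have := (tendsto_one_div_atTop_nhds_zero_nat (𝕜 := ℝ)).pow (k + 1)
    simpa [hb] using this.const_mul (2 * K)
  have tail' (n) (hn : N' ≤ n) (m) (hm : n ≤ m) : |d m - d n| ≤ b n := by
    obtain ⟨j, rfl⟩ := Nat.exists_eq_add_of_le hm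
    linarith [tail n hn j, hb0 (n + j)]
  have hc : CauchySeq d := by
    rw [Metric.cauchySeq_iff']
    intro ε hε
    obtain ⟨n, hn, hn'⟩ := ((hbt.eventually_lt_const hε).and (eventually_ge_atTop N')).exists
    exact ⟨n, fun m hm => (tail' n hn' m hm).trans_lt hn⟩
  obtain ⟨C, hC⟩ := cauchySeq_tendsto_of_complete hc
  refine ⟨C, IsBigO.of_bound (2 * K) ?_⟩
  filter_upwards [eventually_ge_atTop N'] with n hn
  rw [Real.norm_of_nonneg (by positivity : (0 : ℝ) ≤ 1 / (n : ℝ) ^ (k + 1)), norm_sub_rev]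
  exact le_of_tendsto ((hC.sub_const (d n)).norm)
    ((eventually_ge_atTop n).mono fun m hm => tail' n hn m hm)

/-- The reciprocal satisfies 1/x_(n+1) = 1/x_n + 1/(1 - x_n), so it grows by at least 1 at each
step. -/
lemma logistic_orbit_bounds {x : ℕ → ℝ} (h0 : 0 < x 0) (h1 : x 0 < 1)
    (hx : ∀ n, x (n + 1) = x n * (1 - x n)) (n : ℕ) :
    0 < x n ∧ x n < 1 ∧ (n : ℝ) ≤ (x n)⁻¹ := by
  induction n with
  | zero => simp [h0, h1, h0.le]
  | succ n ih =>
    obtain ⟨a, b, c⟩ := ih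
    have b' : 0 < 1 - x n := by linarith
    rw [hx]
    refine ⟨by positivity, by nlinarith, ?_⟩
    have e : (x n * (1 - x n))⁻¹ = (x n)⁻¹ + (1 - x n)⁻¹ := by field_simp; ring
    have : 1 ≤ (1 - x n)⁻¹ := (one_le_inv₀ b').2 (by linarith)
    rw [e]
    push_cast
    linarith

lemma logistic_orbit_isBigO {x : ℕ → ℝ} (h0 : 0 < x 0) (h1 : x 0 < 1)
    (hx : ∀ n, x (n + 1) = x n * (1 - x n)) : x =O[atTop] fun n : ℕ => 1 / (n : ℝ) := by
  refine IsBigO.of_bound 1 ?_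
  filter_upwards [eventually_gt_atTop 0] with n hn
  obtain ⟨a, -, c⟩ := logistic_orbit_bounds h0 h1 hx n
  have hn' : (0 : ℝ) < n := by exact_mod_cast hn
  rw [Real.norm_of_nonneg a.le, Real.norm_of_nonneg (by positivity), one_mul, one_div]
  exact le_inv_of_le_inv₀ hn' c

/-- The approximate Abel function along an orbit. -/
lemma exists_logisticAbel_orbit {x : ℕ → ℝ} (h0 : 0 < x 0) (h1 : x 0 < 1)
    (hx : ∀ n, x (n + 1) = x n * (1 - x n)) :
    ∃ C, (fun n : ℕ => logisticAbel (x n) - n - C) =O[atTop] fun n : ℕ => 1 / (n : ℝ) ^ 6 := by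
  apply exists_lim_of_increment_isBigO (d := fun n => logisticAbel (x n) - n) (k := 5)
  have hO := logistic_orbit_isBigO h0 h1 hx
  have ht : Tendsto x atTop (nhds 0) :=
    hO.trans_tendsto tendsto_one_div_atTop_nhds_zero_nat
  have h := (logisticAbel_step_isBigO.comp_tendsto ht).trans (hO.pow 7)
  refine h.congr (fun n => ?_) fun n => by simp
  obtain ⟨a, b, -⟩ := logistic_orbit_bounds h0 h1 hx n
  have b' : 1 - x n ≠ 0 := by linarith
  have e : (x n * (1 - x n))⁻¹ = (x n)⁻¹ + (1 - x n)⁻¹ := by field_simp; ring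
  simp only [Function.comp, ← sub_eq_add_neg, hx, logisticAbel]
  rw [Real.log_mul a.ne' b', e]
  push_cast
  ring

/-! ### Calculus of graded asymptotic expansions. -/

/-- `HasJet N u f A`: the real sequence `f` is `∑ m < N, coeff m A` up to `O(u ^ N)`, where the
coefficient of order `m` of `A` is a sequence of size `O(u ^ m)`. -/
def HasJet (N : ℕ) (u : ℕ → ℝ) (f : ℕ → ℝ) (A : PowerSeries (ℕ → ℝ)) : Prop :=
  (∀ m, A.coeff m =O[atTop] fun n => u n ^ m) ∧
    (fun n => f n - ∑ m ∈ Finset.range N, A.coeff m n) =O[atTop] fun n => u n ^ N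

namespace HasJet

variable {N : ℕ} {u f g : ℕ → ℝ} {A B : PowerSeries (ℕ → ℝ)}

lemma add (hf : HasJet N u f A) (hg : HasJet N u g B) :
    HasJet N u (fun n => f n + g n) (A + B) := by
  refine ⟨fun m => (map_add (PowerSeries.coeff m) A B) ▸ (hf.1 m).add (hg.1 m), (hf.2.add hg.2).congr_left fun n => ?_⟩
  simp only [map_add, Pi.add_apply, Finset.sum_add_distrib]
  ring

lemma const_smul (c : ℝ) (hf : HasJet N u f A) : HasJet N u (fun n => c * f n) (c • A) := by
  refine ⟨fun m => ?_, (hf.2.const_mul_left c).congr_left fun n => ?_⟩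
  · rw [PowerSeries.coeff_smul]
    exact (hf.1 m).const_mul_left c
  · simp only [PowerSeries.coeff_smul, Pi.smul_apply, smul_eq_mul, mul_sub, Finset.mul_sum]

lemma neg (hf : HasJet N u f A) : HasJet N u (fun n => -f n) (-A) := by
  simpa using hf.const_smul (-1)

lemma sub (hf : HasJet N u f A) (hg : HasJet N u g B) :
    HasJet N u (fun n => f n - g n) (A - B) := by
  simpa only [sub_eq_add_neg] using hf.add hg.neg

lemma one : HasJet N u (fun _ => 1) 1 := by
  refine ⟨fun m => ?_, ?_⟩
  · rcases eq_or_ne m 0 with rfl | hm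
    · simpa using isBigO_refl (fun _ : ℕ => (1 : ℝ)) atTop
    · rw [PowerSeries.coeff_one, if_neg hm]
      exact isBigO_zero _ _
  · rcases eq_or_ne N 0 with rfl | hN
    · simpa using isBigO_refl (fun _ : ℕ => (1 : ℝ)) atTop
    · refine (isBigO_zero _ _).congr_left fun n => ?_
      have (m : ℕ) : (PowerSeries.coeff m (1 : PowerSeries (ℕ → ℝ))) n = if m = 0 then 1 else 0 := by
        rw [PowerSeries.coeff_one]; split_ifs <;> rfl
      simp [this, Nat.pos_of_ne_zero hN]

/-- The error splits as (f - ΣA)g + ΣA(g - ΣB) plus the products of degrees i, j < N with i + j ≥ N;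
each is O(u^N) because u tends to 0. -/
lemma mul (hu : Tendsto u atTop (nhds 0)) (hf : HasJet N u f A) (hg : HasJet N u g B) :
    HasJet N u (fun n => f n * g n) (A * B) := by
  have hle {i j : ℕ} (hij : j ≤ i) : (fun n => u n ^ i) =O[atTop] fun n => u n ^ j := by
    have h1 := (hu.pow (i - j)).isBigO_one ℝ
    refine ((isBigO_refl (fun n => u n ^ j) atTop).mul h1).congr (fun n => ?_) fun n => mul_one _
    rw [← pow_add, Nat.add_sub_cancel' hij]
  have hprod (i j : ℕ) : (fun n => A.coeff i n * B.coeff j n) =O[atTop] fun n => u n ^ (i + j) :=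
    ((hf.1 i).mul (hg.1 j)).congr_right fun n => (pow_add _ _ _).symm
  have hcoeff (m n : ℕ) : (A * B).coeff m n
      = ∑ k ∈ Finset.range (m + 1), A.coeff k n * B.coeff (m - k) n := by
    rw [PowerSeries.coeff_mul, Finset.sum_apply,
      ← Finset.Nat.sum_antidiagonal_eq_sum_range_succ (fun i j => A.coeff i n * B.coeff j n)]
    rfl
  refine ⟨fun m => ?_, ?_⟩
  · have : (A * B).coeff m
        = fun n => ∑ k ∈ Finset.range (m + 1), A.coeff k n * B.coeff (m - k) n := funext (hcoeff m)
    rw [this]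
    refine IsBigO.fun_sum fun k hk => ?_
    have := hprod k (m - k)
    rwa [Nat.add_sub_cancel' (Finset.mem_range_succ_iff.1 hk)] at this
  · have hA : (fun n => ∑ m ∈ Finset.range N, A.coeff m n) =O[atTop] fun _ => (1 : ℝ) :=
      IsBigO.fun_sum fun m _ => by simpa using (hf.1 m).trans (hle m.zero_le)
    have hg' : g =O[atTop] fun _ => (1 : ℝ) := by
      have hB : (fun n => ∑ m ∈ Finset.range N, B.coeff m n) =O[atTop] fun _ => (1 : ℝ) :=
        IsBigO.fun_sum fun m _ => by simpa using (hg.1 m).trans (hle m.zero_le)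
      have := (hg.2.trans (hle N.zero_le)).congr_right fun n => pow_zero (u n)
      exact (this.add hB).congr_left fun n => by ring
    have h1 := (hf.2.mul hg').congr_right fun n => mul_one _
    have h2 := (hA.mul hg.2).congr_right fun n => one_mul _
    have h3 : (fun n => ∑ i ∈ Finset.range N, ∑ j ∈ Finset.range N \ Finset.range (N - i),
        A.coeff i n * B.coeff j n) =O[atTop] fun n => u n ^ N := by
      refine IsBigO.fun_sum fun i hi => IsBigO.fun_sum fun j hj => (hprod i j).trans (hle ?_)
      simp only [Finset.mem_sdiff, Finset.mem_range] at hj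
      omega
    refine ((h1.add h2).add h3).congr_left fun n => ?_
    have e : ∑ m ∈ Finset.range N, (A * B).coeff m n
        = ∑ i ∈ Finset.range N, ∑ j ∈ Finset.range (N - i), A.coeff i n * B.coeff j n := by
      simp only [hcoeff]
      exact Finset.sum_range_diag_flip N fun i j => A.coeff i n * B.coeff j n
    have e2 : (∑ i ∈ Finset.range N, A.coeff i n) * (∑ j ∈ Finset.range N, B.coeff j n)
        = ∑ i ∈ Finset.range N, ∑ j ∈ Finset.range N \ Finset.range (N - i),
            A.coeff i n * B.coeff j n
          + ∑ i ∈ Finset.range N, ∑ j ∈ Finset.range (N - i), A.coeff i n * B.coeff j n := by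
      rw [Finset.sum_mul_sum, ← Finset.sum_add_distrib]
      refine Finset.sum_congr rfl fun i _ => ?_
      exact (Finset.sum_sdiff (Finset.range_mono (Nat.sub_le _ _))).symm
    rw [e]
    linear_combination -e2

lemma pow (hu : Tendsto u atTop (nhds 0)) (hf : HasJet N u f A) (k : ℕ) :
    HasJet N u (fun n => f n ^ k) (A ^ k) := by
  induction k with
  | zero => simpa using one
  | succ k ih => simpa only [pow_succ] using ih.mul hu hf

lemma isBigO_of_coeff_eq_zero (hf : HasJet N u f A) (h : ∀ m < N, A.coeff m = 0) :
    f =O[atTop] fun n => u n ^ N := by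
  refine hf.2.congr_left fun n => ?_
  rw [Finset.sum_eq_zero, sub_zero]
  intro m hm
  rw [h m (Finset.mem_range.1 hm)]
  rfl

/-- A finite sum of sequences of sizes `O(u ^ m)` has the jet with these coefficients. -/
lemma of_sum (a : ℕ → ℕ → ℝ) (ha : ∀ m, a m =O[atTop] fun n => u n ^ m) :
    HasJet N u (fun n => ∑ m ∈ Finset.range N, a m n) (PowerSeries.mk a) := by
  refine ⟨fun m => by simpa using ha m, (isBigO_zero _ _).congr_left fun n => ?_⟩
  simp

/-- Jets are not unique: any O(u) sequence may sit wholly in degree 1. Thus 1/n gets degree 1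
although it is smaller than u = log n / n, and the degree then counts powers of 1/n. -/
lemma of_isBigO (hN : 1 < N) {a : ℕ → ℝ} (ha : a =O[atTop] u) :
    HasJet N u a (PowerSeries.C a * PowerSeries.X) := by
  have hc (m : ℕ) : (PowerSeries.C a * PowerSeries.X).coeff m = if m = 1 then a else 0 := by
    rw [PowerSeries.coeff_C_mul, PowerSeries.coeff_X, mul_ite, mul_one, mul_zero]
  refine ⟨fun m => ?_, (isBigO_zero _ _).congr_left fun n => ?_⟩
  · rw [hc]
    split_ifs with h
    · simpa [h] using ha
    · exact isBigO_zero _ _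
  · have (m : ℕ) : (if m = 1 then a else 0 : ℕ → ℝ) n = if m = 1 then a n else 0 := by
      split_ifs <;> rfl
    simp [hc, this, hN]

end HasJet

/-! ### The formal identity that determines the polynomials. -/

/-- The order `≤ 6` jet of `n⁻¹ (Φ (n⁻¹ (1 + w)) - n - C)`, where `Φ` is `logisticAbel`, in terms
of the jets `W` of `w`, `E` of `1 / n` and `Y` of `-(log n + C) / n`. -/
noncomputable def abelJet {R : Type*} [CommRing R] [Algebra ℝ R] (W E Y : R) : R :=
  (-W + W ^ 2 - W ^ 3 + W ^ 4 - W ^ 5 + W ^ 6) + Y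
    + E * (W + (-1 / 2 : ℝ) • W ^ 2 + (1 / 3 : ℝ) • W ^ 3 + (-1 / 4 : ℝ) • W ^ 4
        + (1 / 5 : ℝ) • W ^ 5 + (-1 / 6 : ℝ) • W ^ 6)
    + (1 / 2 : ℝ) • (E ^ 2 * (1 + W)) + (1 / 3 : ℝ) • (E ^ 3 * (1 + W) ^ 2)
    + (13 / 36 : ℝ) • (E ^ 4 * (1 + W) ^ 3) + (113 / 240 : ℝ) • (E ^ 5 * (1 + W) ^ 4)
    + (1187 / 1800 : ℝ) • (E ^ 6 * (1 + W) ^ 5)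

/-- The coefficients of order at most `6` of the powers of a power series without constant term. -/
lemma coeff_pow_of_coeff_zero {R : Type*} [CommRing R] {W : PowerSeries R} {p : ℕ → R}
    (h0 : W.coeff 0 = 0) (h : ∀ k, k ≠ 0 → W.coeff k = p k) :
    ((W ^ 2).coeff 0 = 0 ∧
      (W ^ 2).coeff 1 = 0 ∧
      (W ^ 2).coeff 2 = p 1 ^ 2 ∧
      (W ^ 2).coeff 3 = 2 * p 1 * p 2 ∧
      (W ^ 2).coeff 4 = 2 * p 1 * p 3 + p 2 ^ 2 ∧
      (W ^ 2).coeff 5 = 2 * p 1 * p 4 + 2 * p 2 * p 3 ∧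
      (W ^ 2).coeff 6 = 2 * p 1 * p 5 + 2 * p 2 * p 4 + p 3 ^ 2) ∧
    ((W ^ 3).coeff 0 = 0 ∧
      (W ^ 3).coeff 1 = 0 ∧
      (W ^ 3).coeff 2 = 0 ∧
      (W ^ 3).coeff 3 = p 1 ^ 3 ∧
      (W ^ 3).coeff 4 = 3 * p 1 ^ 2 * p 2 ∧
      (W ^ 3).coeff 5 = 3 * p 1 ^ 2 * p 3 + 3 * p 1 * p 2 ^ 2 ∧
      (W ^ 3).coeff 6 = 3 * p 1 ^ 2 * p 4 + 6 * p 1 * p 2 * p 3 + p 2 ^ 3) ∧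
    ((W ^ 4).coeff 0 = 0 ∧
      (W ^ 4).coeff 1 = 0 ∧
      (W ^ 4).coeff 2 = 0 ∧
      (W ^ 4).coeff 3 = 0 ∧
      (W ^ 4).coeff 4 = p 1 ^ 4 ∧
      (W ^ 4).coeff 5 = 4 * p 1 ^ 3 * p 2 ∧
      (W ^ 4).coeff 6 = 4 * p 1 ^ 3 * p 3 + 6 * p 1 ^ 2 * p 2 ^ 2) ∧
    ((W ^ 5).coeff 0 = 0 ∧
      (W ^ 5).coeff 1 = 0 ∧
      (W ^ 5).coeff 2 = 0 ∧
      (W ^ 5).coeff 3 = 0 ∧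
      (W ^ 5).coeff 4 = 0 ∧
      (W ^ 5).coeff 5 = p 1 ^ 5 ∧
      (W ^ 5).coeff 6 = 5 * p 1 ^ 4 * p 2) ∧
    ((W ^ 6).coeff 0 = 0 ∧
      (W ^ 6).coeff 1 = 0 ∧
      (W ^ 6).coeff 2 = 0 ∧
      (W ^ 6).coeff 3 = 0 ∧
      (W ^ 6).coeff 4 = 0 ∧
      (W ^ 6).coeff 5 = 0 ∧
      (W ^ 6).coeff 6 = p 1 ^ 6) := by
  -- As W has no constant term, the coefficient of degree k of A * W involves only coefficients of A
  -- of degree below k. Hence degree 6 of each power is not needed for the next one.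
  have hm (A : PowerSeries R) (k : ℕ) : (A * W).coeff k
      = ∑ i ∈ Finset.range k, A.coeff i * p (k - i) := by
    rw [PowerSeries.coeff_mul,
      Finset.Nat.sum_antidiagonal_eq_sum_range_succ (fun i j => A.coeff i * W.coeff j),
      Finset.sum_range_succ, Nat.sub_self, h0, mul_zero, add_zero]
    exact Finset.sum_congr rfl fun i hi => by
      rw [h _ (Nat.sub_ne_zero_of_lt (Finset.mem_range.1 hi))]
  have h1 := h 1 one_ne_zero
  have h2 := h 2 (by norm_num)
  have h3 := h 3 (by norm_num)
  have h4 := h 4 (by norm_num)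
  have h5 := h 5 (by norm_num)
  have q2 : (W ^ 2).coeff 0 = 0 ∧
      (W ^ 2).coeff 1 = 0 ∧
      (W ^ 2).coeff 2 = p 1 ^ 2 ∧
      (W ^ 2).coeff 3 = 2 * p 1 * p 2 ∧
      (W ^ 2).coeff 4 = 2 * p 1 * p 3 + p 2 ^ 2 ∧
      (W ^ 2).coeff 5 = 2 * p 1 * p 4 + 2 * p 2 * p 3 ∧
      (W ^ 2).coeff 6 = 2 * p 1 * p 5 + 2 * p 2 * p 4 + p 3 ^ 2 := by
    refine ⟨?_, ?_, ?_, ?_, ?_, ?_, ?_⟩ <;>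
    simp only [sq, hm, Finset.sum_range_succ, Finset.sum_range_zero,
      h0, h1, h2, h3, h4, h5] <;>
    ring
  obtain ⟨a2, b2, c2, d2, e2, f2, -⟩ := id q2
  have q3 : (W ^ 3).coeff 0 = 0 ∧
      (W ^ 3).coeff 1 = 0 ∧
      (W ^ 3).coeff 2 = 0 ∧
      (W ^ 3).coeff 3 = p 1 ^ 3 ∧
      (W ^ 3).coeff 4 = 3 * p 1 ^ 2 * p 2 ∧
      (W ^ 3).coeff 5 = 3 * p 1 ^ 2 * p 3 + 3 * p 1 * p 2 ^ 2 ∧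
      (W ^ 3).coeff 6 = 3 * p 1 ^ 2 * p 4 + 6 * p 1 * p 2 * p 3 + p 2 ^ 3 := by
    refine ⟨?_, ?_, ?_, ?_, ?_, ?_, ?_⟩ <;>
    simp only [pow_succ W 2, hm, Finset.sum_range_succ, Finset.sum_range_zero,
      a2, b2, c2, d2, e2, f2] <;>
    ring
  obtain ⟨a3, b3, c3, d3, e3, f3, -⟩ := id q3
  have q4 : (W ^ 4).coeff 0 = 0 ∧
      (W ^ 4).coeff 1 = 0 ∧
      (W ^ 4).coeff 2 = 0 ∧
      (W ^ 4).coeff 3 = 0 ∧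
      (W ^ 4).coeff 4 = p 1 ^ 4 ∧
      (W ^ 4).coeff 5 = 4 * p 1 ^ 3 * p 2 ∧
      (W ^ 4).coeff 6 = 4 * p 1 ^ 3 * p 3 + 6 * p 1 ^ 2 * p 2 ^ 2 := by
    refine ⟨?_, ?_, ?_, ?_, ?_, ?_, ?_⟩ <;>
    simp only [pow_succ W 3, hm, Finset.sum_range_succ, Finset.sum_range_zero,
      a3, b3, c3, d3, e3, f3] <;>
    ring
  obtain ⟨a4, b4, c4, d4, e4, f4, -⟩ := id q4
  have q5 : (W ^ 5).coeff 0 = 0 ∧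
      (W ^ 5).coeff 1 = 0 ∧
      (W ^ 5).coeff 2 = 0 ∧
      (W ^ 5).coeff 3 = 0 ∧
      (W ^ 5).coeff 4 = 0 ∧
      (W ^ 5).coeff 5 = p 1 ^ 5 ∧
      (W ^ 5).coeff 6 = 5 * p 1 ^ 4 * p 2 := by
    refine ⟨?_, ?_, ?_, ?_, ?_, ?_, ?_⟩ <;>
    simp only [pow_succ W 4, hm, Finset.sum_range_succ, Finset.sum_range_zero,
      a4, b4, c4, d4, e4, f4] <;>
    ring
  obtain ⟨a5, b5, c5, d5, e5, f5, -⟩ := id q5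
  have q6 : (W ^ 6).coeff 0 = 0 ∧
      (W ^ 6).coeff 1 = 0 ∧
      (W ^ 6).coeff 2 = 0 ∧
      (W ^ 6).coeff 3 = 0 ∧
      (W ^ 6).coeff 4 = 0 ∧
      (W ^ 6).coeff 5 = 0 ∧
      (W ^ 6).coeff 6 = p 1 ^ 6 := by
    refine ⟨?_, ?_, ?_, ?_, ?_, ?_, ?_⟩ <;>
    simp only [pow_succ W 5, hm, Finset.sum_range_succ, Finset.sum_range_zero,
      a5, b5, c5, d5, e5, f5] <;>
    ring
  exact ⟨q2, q3, q4, q5, q6⟩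

/-- In degree m ≥ 1 the coefficient is e^m times -P_m plus a polynomial in X and the earlier P_k, so
its vanishing is the recursion defining P_m. X and e are free reals here, and `ring` checks each
degree. -/
lemma coeff_abelJet_eq_zero (X e : ℝ) {m : ℕ} (hm : m < 7) :
    PowerSeries.coeff m (abelJet
      (PowerSeries.mk fun k => if k = 0 then 0 else logisticP k X * e ^ k)
      (PowerSeries.C e * PowerSeries.X) (PowerSeries.C (X * e) * PowerSeries.X)) = 0 := by
  set W : PowerSeries ℝ := PowerSeries.mk fun k => if k = 0 then 0 else logisticP k X * e ^ k
  have hW (k) : W.coeff k = if k = 0 then 0 else logisticP k X * e ^ k := PowerSeries.coeff_mk _ _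
  have hC (k : ℕ) (A : PowerSeries ℝ) (a : ℝ) (j : ℕ) :
      ((PowerSeries.C a * PowerSeries.X) ^ j * A).coeff k
        = a ^ j * if j ≤ k then A.coeff (k - j) else 0 := by
    rw [mul_pow, mul_assoc, ← map_pow, PowerSeries.coeff_C_mul, PowerSeries.coeff_X_pow_mul']
  have hC1 (k : ℕ) (A : PowerSeries ℝ) (a : ℝ) :
      ((PowerSeries.C a * PowerSeries.X) * A).coeff k
        = a * if 1 ≤ k then A.coeff (k - 1) else 0 := by
    simpa using hC k A a 1
  have hX (k : ℕ) (a : ℝ) : ((PowerSeries.C a * PowerSeries.X) : PowerSeries ℝ).coeff k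
        = if k = 1 then a else 0 := by
    rw [PowerSeries.coeff_C_mul, PowerSeries.coeff_X, mul_ite, mul_one, mul_zero]
  unfold abelJet
  simp only [map_add, map_sub, map_neg, map_smul, hC, hC1, hX]
  have o5 : (1 + W) ^ 5 = 1 + (5 : ℝ) • W + (10 : ℝ) • W ^ 2 + (10 : ℝ) • W ^ 3
      + (5 : ℝ) • W ^ 4 + W ^ 5 := by simp only [Algebra.smul_def, map_ofNat]; ring
  have o4 : (1 + W) ^ 4 = 1 + (4 : ℝ) • W + (6 : ℝ) • W ^ 2 + (4 : ℝ) • W ^ 3 + W ^ 4 := by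
    simp only [Algebra.smul_def, map_ofNat]; ring
  have o3 : (1 + W) ^ 3 = 1 + (3 : ℝ) • W + (3 : ℝ) • W ^ 2 + W ^ 3 := by
    simp only [Algebra.smul_def, map_ofNat]; ring
  have o2 : (1 + W) ^ 2 = 1 + (2 : ℝ) • W + W ^ 2 := by
    simp only [Algebra.smul_def, map_ofNat]; ring
  -- These coefficient formulas stay unnamed and enter through `simp only [*]`.
  obtain ⟨⟨_, _, _, _, _, _, _⟩, ⟨_, _, _, _, _, _, _⟩, ⟨_, _, _, _, _, _, _⟩,
    ⟨_, _, _, _, _, _, _⟩, ⟨_, _, _, _, _, _, _⟩⟩ := coeff_pow_of_coeff_zero (W := W)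
    (p := fun k => logisticP k X * e ^ k) (by simp [hW]) fun k hk => by rw [hW, if_neg hk]
  rw [o2, o3, o4, o5]
  simp only [map_add, map_smul, smul_eq_mul, PowerSeries.coeff_one]
  interval_cases m <;>
    simp only [*, Nat.reduceSub, Nat.reduceLeDiff, OfNat.ofNat_ne_zero, OfNat.ofNat_ne_one,
      zero_ne_one, one_ne_zero, nonpos_iff_eq_zero, le_refl, if_true, if_false, logisticP] <;>
    ring

/-- Applied to evaluation at a fixed n, this reduces the identity for sequence coefficients to the
one for real coefficients. -/
lemma map_abelJet {R S : Type*} [CommRing R] [Algebra ℝ R] [CommRing S] [Algebra ℝ S]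
    (φ : R →ₐ[ℝ] S) (W E Y : R) : φ (abelJet W E Y) = abelJet (φ W) (φ E) (φ Y) := by
  simp only [abelJet, map_add, map_sub, map_neg, map_mul, map_pow, map_smul, map_one]

lemma HasJet.abelJet {N : ℕ} {u w e y : ℕ → ℝ} {W E Y : PowerSeries (ℕ → ℝ)}
    (hu : Tendsto u atTop (nhds 0)) (hw : HasJet N u w W) (he : HasJet N u e E)
    (hy : HasJet N u y Y) :
    HasJet N u (fun n => _root_.abelJet (w n) (e n) (y n)) (_root_.abelJet W E Y) := by
  have p (k : ℕ) := hw.pow hu k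
  have q (k : ℕ) := he.pow hu k
  have r (k : ℕ) := (HasJet.one.add hw).pow hu k
  exact ((((((((((hw.neg.add (p 2)).sub (p 3)).add (p 4)).sub (p 5)).add (p 6)).add hy).add
    (he.mul hu (((((hw.add ((p 2).const_smul _)).add ((p 3).const_smul _)).add
      ((p 4).const_smul _)).add ((p 5).const_smul _)).add ((p 6).const_smul _)))).add
    (((q 2).mul hu (HasJet.one.add hw)).const_smul _)).add
    (((q 3).mul hu (r 2)).const_smul _)).add
    (((q 4).mul hu (r 3)).const_smul _)).add
    (((q 5).mul hu (r 4)).const_smul _) |>.add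
    (((q 6).mul hu (r 5)).const_smul _)

/-! ### The partial sums in the scale `log n / n`. -/

lemma one_isBigO_log : (fun _ : ℕ => (1 : ℝ)) =O[atTop] fun n : ℕ => Real.log n :=
  (isLittleO_const_left.2 <| .inr <| tendsto_norm_atTop_atTop.comp <|
    Real.tendsto_log_atTop.comp tendsto_natCast_atTop_atTop).isBigO

lemma neg_log_add_isBigO (C : ℝ) :
    (fun n : ℕ => -(Real.log n + C)) =O[atTop] fun n : ℕ => Real.log n :=
  (((isBigO_refl _ _).add ((isBigO_const_const C one_ne_zero _).trans one_isBigO_log))).neg_left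

lemma logisticP_isBigO (C : ℝ) (m : ℕ) :
    (fun n : ℕ => logisticP m (-(Real.log n + C))) =O[atTop] fun n : ℕ => Real.log n ^ m := by
  have hp (k : ℕ) (hk : k ≤ m) (c : ℝ) : (fun n : ℕ => c * (-(Real.log n + C)) ^ k)
      =O[atTop] fun n : ℕ => Real.log n ^ m := by
    have h := ((neg_log_add_isBigO C).pow k).mul (one_isBigO_log.pow (m - k))
    refine (h.const_mul_left c).congr (fun n => by simp) fun n => ?_
    rw [← pow_add, Nat.add_sub_cancel' hk]
  have h0 (c : ℝ) : (fun _ : ℕ => c) =O[atTop] fun n : ℕ => Real.log n ^ m :=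
    (hp 0 m.zero_le c).congr_left fun n => by rw [pow_zero, mul_one]
  have hm : (fun n : ℕ => (-(Real.log n + C)) ^ m) =O[atTop] fun n : ℕ => Real.log n ^ m :=
    (hp m le_rfl 1).congr_left fun n => one_mul _
  have h1 (hk : 1 ≤ m) (c : ℝ) : (fun n : ℕ => c * -(Real.log n + C))
      =O[atTop] fun n : ℕ => Real.log n ^ m := (hp 1 hk c).congr_left fun n => by rw [pow_one]
  match m with
  | 0 => exact h0 1
  | 1 => exact (h1 le_rfl 1).congr_left fun n => one_mul _
  | 2 => exact (hm.add ((h1 (by norm_num) 1).congr_left fun n => one_mul _)).add (h0 _)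
  | 3 => exact ((hm.add (hp 2 (by norm_num) _)).add (h1 (by norm_num) _)).add (h0 _)
  | 4 => exact (((hm.add (hp 3 (by norm_num) _)).add (hp 2 (by norm_num) _)).add
      (h1 (by norm_num) _)).add (h0 _)
  | 5 => exact ((((hm.add (hp 4 (by norm_num) _)).add (hp 3 (by norm_num) _)).add
      (hp 2 (by norm_num) _)).add (h1 (by norm_num) _)).add (h0 _)
  | 6 => exact (((((hm.add (hp 5 (by norm_num) _)).add (hp 4 (by norm_num) _)).add
      (hp 3 (by norm_num) _)).add (hp 2 (by norm_num) _)).add (h1 (by norm_num) _)).add (h0 _)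
  | _ + 7 => exact isBigO_zero _ _

lemma tendsto_log_div_natCast :
    Tendsto (fun n : ℕ => Real.log n / n) atTop (nhds 0) :=
  Real.isLittleO_log_id_atTop.tendsto_div_nhds_zero.comp tendsto_natCast_atTop_atTop

lemma logisticP_mul_isBigO (C : ℝ) (m : ℕ) :
    (fun n : ℕ => logisticP m (-(Real.log n + C)) * (1 / (n : ℝ) ^ m))
      =O[atTop] fun n : ℕ => (Real.log n / n) ^ m :=
  ((logisticP_isBigO C m).mul (isBigO_refl _ _)).congr_right fun n => by
    rw [div_pow, mul_one_div]

/-- The partial sum of order `6` solves `Φ z = n + C` up to `O(log n ^ 7 / n ^ 6)`. -/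
lemma logisticAbel_partialSum_isBigO (C : ℝ) :
    (∀ᶠ n : ℕ in atTop, 0 < logisticPartialSum C 6 n) ∧
    (fun n : ℕ => logisticPartialSum C 6 n) =O[atTop] (fun n : ℕ => 1 / (n : ℝ)) ∧
    (fun n : ℕ => 1 / (n : ℝ) * (logisticAbel (logisticPartialSum C 6 n) - n - C))
      =O[atTop] fun n : ℕ => (Real.log n / n) ^ 7 := by
  set u : ℕ → ℝ := fun n => Real.log n / n
  have hu : Tendsto u atTop (nhds 0) := tendsto_log_div_natCast
  -- Degree 0 is set to 0 rather than `logisticP 0 = 1`, so that z_n = (1 + w)/n with w = O(u).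
  set a : ℕ → ℕ → ℝ := fun m n =>
    if m = 0 then 0 else logisticP m (-(Real.log n + C)) * (1 / (n : ℝ)) ^ m with ha
  have hao (m : ℕ) : a m =O[atTop] fun n => u n ^ m := by
    rcases eq_or_ne m 0 with rfl | hm
    · exact (isBigO_zero _ _).congr_left fun n => (if_pos rfl).symm
    · simpa only [ha, if_neg hm, one_div_pow] using logisticP_mul_isBigO C m
  set w : ℕ → ℝ := fun n => ∑ m ∈ Finset.range 7, a m n with hw
  have hz (n : ℕ) : logisticPartialSum C 6 n = 1 / n * (1 + w n) := by
    simp only [logisticPartialSum, hw, ha, Finset.sum_range_succ', Finset.sum_range_zero,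
      Finset.sum_Icc_succ_top, Nat.le_add_left, one_div_pow]
    simp only [zero_add, Nat.reduceAdd, Finset.Icc_eq_empty_of_lt, zero_lt_one, Finset.sum_empty,
      if_true, if_false, OfNat.ofNat_ne_zero, one_ne_zero]
    ring
  have hwu : w =O[atTop] u := by
    refine IsBigO.fun_sum fun m _ => ?_
    rcases m with _ | m
    · exact (isBigO_zero _ _).congr_left fun n => (if_pos rfl).symm
    · refine (hao (m + 1)).trans ?_
      simpa [pow_succ'] using (isBigO_refl u atTop).mul ((hu.pow m).isBigO_one ℝ)
  have hw0 : Tendsto w atTop (nhds 0) := hwu.trans_tendsto hu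
  have hpos : ∀ᶠ n in atTop, 0 < 1 + w n := by
    filter_upwards [hw0.eventually_const_lt (show (-1 : ℝ) < 0 by norm_num)] with n hn
    linarith
  refine ⟨?_, ?_, ?_⟩
  · filter_upwards [hpos, eventually_gt_atTop 0] with n hn hn0
    rw [hz]
    positivity
  · have h1 : (fun n => 1 + w n) =O[atTop] fun _ => (1 : ℝ) :=
      (hw0.const_add 1).isBigO_one ℝ
    exact ((isBigO_refl (fun n : ℕ => 1 / (n : ℝ)) atTop).mul h1).congr
      (fun n => (hz n).symm) fun n => mul_one _
  · have hJw : HasJet 7 u w (PowerSeries.mk a) := HasJet.of_sum a hao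
    have heu : (fun n : ℕ => 1 / (n : ℝ)) =O[atTop] u :=
      (one_isBigO_log.mul (isBigO_refl (fun n : ℕ => 1 / (n : ℝ)) atTop)).congr
        (fun n => one_mul _) fun n => mul_one_div _ _
    have hyu : (fun n : ℕ => -(Real.log n + C) * (1 / (n : ℝ))) =O[atTop] u :=
      ((neg_log_add_isBigO C).mul (isBigO_refl (fun n : ℕ => 1 / (n : ℝ)) atTop)).congr_right
        fun n => mul_one_div _ _
    have hJ := hJw.abelJet hu (HasJet.of_isBigO (by norm_num) heu)
      (HasJet.of_isBigO (by norm_num) hyu)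
    have hF := hJ.isBigO_of_coeff_eq_zero fun m hm => by
      funext n
      set φ := PowerSeries.mapAlgHom (Pi.evalAlgHom ℝ (fun _ : ℕ => ℝ) n)
      have hφ (A : PowerSeries (ℕ → ℝ)) (k : ℕ) : A.coeff k n = (φ A).coeff k := by
        rfl
      rw [hφ, map_abelJet]
      have := coeff_abelJet_eq_zero (-(Real.log n + C)) (1 / (n : ℝ)) hm
      have e1 : φ (PowerSeries.mk a) = PowerSeries.mk fun k => if k = 0 then 0 else
          logisticP k (-(Real.log n + C)) * (1 / (n : ℝ)) ^ k := by
        ext k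
        rw [← hφ, PowerSeries.coeff_mk, PowerSeries.coeff_mk]
      have e2 (b : ℕ → ℝ) : φ (PowerSeries.C b * PowerSeries.X)
          = PowerSeries.C (b n) * PowerSeries.X := by
        ext k
        rw [← hφ, PowerSeries.coeff_C_mul, PowerSeries.coeff_C_mul, PowerSeries.coeff_X,
          PowerSeries.coeff_X]
        split_ifs <;> rfl
      rw [e1, e2, e2, this]
      rfl
    -- `abelJet` contains truncated series; replacing them by the true inverse and logarithm costs
    -- O(w^7) = O(u^7).
    have h1 := ((inv_one_add_isBigO 7).comp_tendsto hw0).trans (hwu.pow 7)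
    have h2 := ((log_one_add_isBigO 6).comp_tendsto hw0).trans (hwu.pow 7)
    have h3 := (tendsto_one_div_atTop_nhds_zero_nat (𝕜 := ℝ)).isBigO_one ℝ |>.mul h2
      |>.congr_right fun n => one_mul _
    refine ((h1.add h3).add hF).congr' ?_ EventuallyEq.rfl
    filter_upwards [hpos, eventually_gt_atTop 0] with n hn hn0
    have hn' : (n : ℝ) ≠ 0 := by positivity
    rw [hz, logisticAbel, Real.log_mul (by positivity) hn.ne', one_div, Real.log_inv, mul_inv,
      inv_inv]
    simp only [Function.comp, abelJet, abelPoly, Finset.sum_range_succ, Finset.sum_range_zero,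
      smul_eq_mul]
    have : (n : ℝ)⁻¹ * (n * (1 + w n)⁻¹ + (-Real.log n + Real.log (1 + w n))
        + abelPoly ((n : ℝ)⁻¹ * (1 + w n)) - n - C) = (1 + w n)⁻¹ - 1
        + (n : ℝ)⁻¹ * (-Real.log n + Real.log (1 + w n)
        + abelPoly ((n : ℝ)⁻¹ * (1 + w n)) - C) := by
      field_simp
      ring
    rw [abelPoly] at this
    rw [this]
    push_cast
    ring

lemma log_pow_div_isBigO {i j : ℕ} (hij : j ≤ i) :
    (fun n : ℕ => Real.log n ^ i / (n : ℝ) ^ (i + 1))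
      =O[atTop] fun n : ℕ => Real.log n ^ j / (n : ℝ) ^ (j + 1) := by
  have h := (isBigO_refl (fun n : ℕ => Real.log n ^ j / (n : ℝ) ^ (j + 1)) atTop).mul
    ((tendsto_log_div_natCast.pow (i - j)).isBigO_one ℝ)
  refine h.congr (fun n => ?_) fun n => mul_one _
  rw [div_pow, div_mul_div_comm, ← pow_add, ← pow_add, Nat.add_sub_cancel',
    show j + 1 + (i - j) = i + 1 by omega]
  exact hij

/-- Truncating the partial sums of the expansion. -/
lemma logisticPartialSum_sub_isBigO (C : ℝ) {M K : ℕ} (hMK : M ≤ K) :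
    (fun n : ℕ => logisticPartialSum C K n - logisticPartialSum C M n)
      =O[atTop] fun n : ℕ => Real.log n ^ (M + 1) / (n : ℝ) ^ (M + 2) := by
  induction K, hMK using Nat.le_induction with
  | base => simpa using isBigO_zero (fun n : ℕ => Real.log n ^ (M + 1) / (n : ℝ) ^ (M + 2)) atTop
  | succ K hK ih =>
    have h := (isBigO_refl (fun n : ℕ => 1 / (n : ℝ)) atTop).mul (logisticP_mul_isBigO C (K + 1))
    have h' := (h.congr_right (g₂ := fun n : ℕ => Real.log n ^ (K + 1) / (n : ℝ) ^ (K + 2))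
      fun n => by rw [div_pow, div_mul_div_comm, one_mul, ← pow_succ']).trans
      (log_pow_div_isBigO (Nat.succ_le_succ hK))
    refine (ih.add h').congr_left fun n => ?_
    rw [logisticPartialSum, logisticPartialSum, logisticPartialSum,
      Finset.sum_Icc_succ_top (Nat.le_add_left _ _)]
    ring

/-- The prefactor 1/n shifts degrees by one: the terms written out, down to n^(-6), form the partial
sum with M = 5. -/
lemma logisticExpanded_eq (C : ℝ) (n : ℕ) :
    logisticExpanded C (Real.log n) n = logisticPartialSum C 5 n := by
  have hs (f : ℕ → ℝ) : ∑ m ∈ Finset.Icc 1 5, f m = f 1 + f 2 + f 3 + f 4 + f 5 := by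
    simp [Finset.sum_Icc_succ_top]
  rw [logisticPartialSum, hs]
  simp only [logisticExpanded, logisticP]
  ring

/-! ### Comparison of the orbit with the partial sums. -/

/-- The expansion of order `6` along an orbit of the logistic map. -/
lemma logistic_orbit_sub_partialSum_isBigO {x : ℕ → ℝ} (h0 : 0 < x 0) (h1 : x 0 < 1)
    (hx : ∀ n, x (n + 1) = x n * (1 - x n)) {C : ℝ}
    (hC : (fun n : ℕ => logisticAbel (x n) - n - C) =O[atTop] fun n : ℕ => 1 / (n : ℝ) ^ 6) :
    (fun n : ℕ => x n - logisticPartialSum C 6 n)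
      =O[atTop] fun n : ℕ => Real.log n ^ 7 / (n : ℝ) ^ 8 := by
  set z : ℕ → ℝ := fun n => logisticPartialSum C 6 n
  obtain ⟨hz, hzO, hzA⟩ := logisticAbel_partialSum_isBigO C
  have hxO := logistic_orbit_isBigO h0 h1 hx
  have ht := tendsto_one_div_atTop_nhds_zero_nat (𝕜 := ℝ)
  have hxs := (hxO.trans_tendsto ht).eventually_le_const (show (0 : ℝ) < 1 / 8 by norm_num)
  have hzs := (hzO.trans_tendsto ht).eventually_le_const (show (0 : ℝ) < 1 / 8 by norm_num)
  have hxA : (fun n : ℕ => 1 / (n : ℝ) * (logisticAbel (x n) - n - C))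
      =O[atTop] fun n : ℕ => (Real.log n / n) ^ 7 := by
    have h := (isBigO_refl (fun n : ℕ => 1 / (n : ℝ)) atTop).mul hC
    refine (h.congr_right (g₂ := fun n : ℕ => 1 * (1 / (n : ℝ) ^ 7)) fun n => ?_).trans ?_
    · rw [one_div_mul_one_div, ← pow_succ', one_mul]
    · refine (((one_isBigO_log.pow 7).congr_left fun n => one_pow 7).mul
        (isBigO_refl (fun n : ℕ => 1 / (n : ℝ) ^ 7) atTop)).congr_right fun n => ?_
      rw [div_pow, mul_one_div]
  have hinv : (fun n : ℕ => 1 / (n : ℝ) * ((z n)⁻¹ - (x n)⁻¹))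
      =O[atTop] fun n : ℕ => (Real.log n / n) ^ 7 := by
    refine (IsBigO.of_bound 2 ?_).trans (hxA.sub hzA)
    filter_upwards [hz, hxs, hzs] with n hz hxs hzs
    have := abs_inv_sub_inv_le (logistic_orbit_bounds h0 h1 hx n).1 hz hxs hzs
    rw [← mul_sub, norm_mul, norm_mul, Real.norm_eq_abs (_ - _), Real.norm_eq_abs (_ - _),
      abs_sub_comm (z n)⁻¹, sub_sub_sub_cancel_right, sub_sub_sub_cancel_right, mul_left_comm]
    gcongr
  -- x - z = n · x · z · (1/n)(1/z - 1/x), of size n · n^(-1) · n^(-1) · (log n / n)^7.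
  have h := (isBigO_refl (fun n : ℕ => (n : ℝ)) atTop).mul (hxO.mul (hzO.mul hinv))
  refine h.congr' ?_ ?_
  · filter_upwards [hz, eventually_gt_atTop 0] with n hz hn
    have hx0 := (logistic_orbit_bounds h0 h1 hx n).1.ne'
    have hz0 : z n ≠ 0 := hz.ne'
    have hn0 : (n : ℝ) ≠ 0 := by positivity
    change (n : ℝ) * (x n * (z n * (1 / n * ((z n)⁻¹ - (x n)⁻¹)))) = x n - z n
    field_simp
  · filter_upwards [eventually_gt_atTop 0] with n hn
    field_simp

theorem mainTheorem3 :
    ∃ C : ℝ → ℝ, ∀ x : ℕ → ℝ, 0 < x 0 → x 0 < 1 →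
      (∀ n : ℕ, 1 ≤ n → x n = x (n - 1) * (1 - x (n - 1))) →
      (∀ M : ℕ, M ≤ 6 →
        (fun n : ℕ => x n - logisticPartialSum (C (x 0)) M n)
          =O[atTop] (fun n : ℕ => Real.log n ^ (M + 1) / (n : ℝ) ^ (M + 2))) ∧
      (fun n : ℕ => x n - logisticExpanded (C (x 0)) (Real.log n) n)
        =O[atTop] (fun n : ℕ => Real.log n ^ 6 / (n : ℝ) ^ 7) := by
  -- C must depend on the initial value alone, so it is chosen from the iterates of each real c;
  -- outside (0, 1) the value 0 is a dummy.
  have hex (c : ℝ) : ∃ C, 0 < c → c < 1 →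
      (fun n : ℕ => logisticAbel ((fun t => t * (1 - t))^[n] c) - n - C)
        =O[atTop] fun n : ℕ => 1 / (n : ℝ) ^ 6 := by
    by_cases hc : 0 < c ∧ c < 1
    · obtain ⟨C, hC⟩ := exists_logisticAbel_orbit (x := fun n => (fun t => t * (1 - t))^[n] c)
        hc.1 hc.2 fun n => Function.iterate_succ_apply' _ _ _
      exact ⟨C, fun _ _ => hC⟩
    · exact ⟨0, fun h h' => absurd ⟨h, h'⟩ hc⟩
  choose C hC using hex
  refine ⟨C, fun x h0 h1 hx => ?_⟩
  have hx' (n : ℕ) : x (n + 1) = x n * (1 - x n) := hx (n + 1) (Nat.le_add_left _ _)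
  have hit (n : ℕ) : (fun t => t * (1 - t))^[n] (x 0) = x n := by
    induction n with
    | zero => rfl
    | succ n ih => rw [Function.iterate_succ_apply', ih, hx']
  have hCx := hC (x 0) h0 h1
  simp only [hit] at hCx
  have key := logistic_orbit_sub_partialSum_isBigO h0 h1 hx' hCx
  have main (M : ℕ) (hM : M ≤ 6) : (fun n : ℕ => x n - logisticPartialSum (C (x 0)) M n)
      =O[atTop] fun n : ℕ => Real.log n ^ (M + 1) / (n : ℝ) ^ (M + 2) :=
    ((key.trans (log_pow_div_isBigO (Nat.succ_le_succ hM))).add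
      (logisticPartialSum_sub_isBigO (C (x 0)) hM)).congr_left fun n => by ring
  exact ⟨main, by simpa only [logisticExpanded_eq] using main 5 (by norm_num)⟩
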